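/- **Setting.** Let $\alpha_1,\alpha_2,\alpha_3,\beta>-1$ be real with $\alpha_i-\alpha_j\notin\mathbb Z$ for $i\ne j$, and let $d\mu=(d\mu_1,d\mu_2,d\mu_3)$ with $d\mu_a=x^{\alpha_a}(1-x)^\beta\,dx$ on $[0,1]$ (Jacobi–Piñeiro measures). For a row $d\nu=(d\nu_1,d\nu_2,d\nu_3)$ of (possibly complex) measures and $n\ge 0$, let $(n_1,n_2,n_3)$, $n_a=\lceil (n-a+1)/3\rceil$, be the step-line multi-index of size $n$: $(0,0,0),(1,0,0),(1,1,0),(1,1,1),(2,1,1),\dots$. One says that orthogonality exists for $d\nu$ if all leading principal submatrices of the moment matrix $\mathscr M_{i,3m+a-1}=\int x^{i+m}\,d\nu_a$ ($i,m\ge0$, $a=1,2,3$) are invertible. In that case, for every $n\ge0$: * the type II polynomial $P_n$ is the unique monic polynomial of degree $n$ with $\int P_n(x)x^l\,d\nu_a=0$ for $a=1,2,3$ and $0\le l<n_a$; * the type I polynomials $P_n^{(1)},P_n^{(2)},P_n^{(3)}$ are the unique polynomials with $\deg P_n^{(a)}<(n+1)_a$ (so that $P_n^{(a)}=0$ if $(n+1)_a=0$),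 $\int x^l\sum_{a}P_n^{(a)}\,d\nu_a=0$ for $0\le l<n$ and $\int x^n\sum_aP_n^{(a)}\,d\nu_a=1$. Thus $\int P_m\sum_a P_n^{(a)}d\nu_a=\delta_{m,n}$; the multi-index of $P_n^{(a)}$ has size $n+1$. For $d\nu=d\mu$ orthogonality exists; write $P_n$, $P_n^{(a)}$ for these Jacobi–Piñeiro polynomials and $$D_n^{(a)}(z)=\int_0^1\frac{P_n(x)}{z-x}\,d\mu_a(x).$$ Let $c,d\in(-\infty,0]\cup[1,\infty)$, where $\beta>0$ is assumed if $c=1$ and $\alpha_2,\alpha_3>0$ if $c=0$ (so that the integrals $D_n^{(2)}(c)$, $D_n^{(3)}(c)$ converge), and let $\xi^{(1)},\xi^{(2)}$ be arbitrary complex-valued functions. Consider the perturbed row of measures $$d\tilde\mu_2=\left(\tfrac{x-d}{c-x}d\mu_2+(c-d)\xi^{(1)}(c)\delta_c,\ \ \tfrac{x-d}{c-x}d\mu_3+(c-d)\xi^{(2)}(c)\delta_c,\ \ (x-d)d\mu_1\right),$$ which satisfies $$d\tilde\mu_2(x)\,P_2(x)=(x-d)\,d\mu(x),\qquad P_2(x)=\begin{bmatrix}0&c-x&0\\0&0&c-x\\1&0&0\end{bmatrix}.$$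 Assume that orthogonality exists for $d\tilde\mu_2$, and denote its type II and type I polynomials by $\tilde P_n$ and $\tilde P_n^{(a)}$. Abbreviate $$\mathsf W_k^{(2)}=D_k^{(2)}(c)+\xi^{(1)}(c)P_k(c),\qquad \mathsf W_k^{(3)}=D_k^{(3)}(c)+\xi^{(2)}(c)P_k(c),$$ and, for $n\ge2$, $$\tau_n=\begin{vmatrix}P_{n-2}(d)&\mathsf W_{n-2}^{(2)}&\mathsf W_{n-2}^{(3)}\\P_{n-1}(d)&\mathsf W_{n-1}^{(2)}&\mathsf W_{n-1}^{(3)}\\P_{n}(d)&\mathsf W_{n}^{(2)}&\mathsf W_{n}^{(3)}\end{vmatrix}.$$ **Proposition.** For every $n>1$ one has $\tau_n\neq0$, and the following Christoffel-type formulas hold. Type I: for all $x\in\mathbb C$, $$\begin{bmatrix}\tilde P^{(1)}_{n-1}(x)\\\tilde P^{(2)}_{n-1}(x)\\\tilde P^{(3)}_{n-1}(x)\end{bmatrix}=\frac1{\tau_n}\sum_{i=0}^{n-3}\begin{vmatrix}P_{i}(d)&\mathsf W_{i}^{(2)}&\mathsf W_{i}^{(3)}\\P_{n-2}(d)&\mathsf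 W_{n-2}^{(2)}&\mathsf W_{n-2}^{(3)}\\P_{n-1}(d)&\mathsf W_{n-1}^{(2)}&\mathsf W_{n-1}^{(3)}\end{vmatrix}\begin{bmatrix}(x-c)P_i^{(2)}(x)\\(x-c)P_i^{(3)}(x)\\-P_i^{(1)}(x)\end{bmatrix}+\frac1{\tau_n}\begin{bmatrix}-\begin{vmatrix}P_{n-2}(d)&\mathsf W_{n-2}^{(3)}\\P_{n-1}(d)&\mathsf W_{n-1}^{(3)}\end{vmatrix}\\[8pt]\begin{vmatrix}P_{n-2}(d)&\mathsf W_{n-2}^{(2)}\\P_{n-1}(d)&\mathsf W_{n-1}^{(2)}\end{vmatrix}\\[4pt]0\end{bmatrix}$$ (the sum being empty for $n=2$). Type II: for all $x\in\mathbb C$, $x\ne d$, $$\tilde P_n(x)=\frac1{\tau_n\,(x-d)}\begin{vmatrix}P_{n-2}(d)&\mathsf W_{n-2}^{(2)}&\mathsf W_{n-2}^{(3)}&P_{n-2}(x)\\P_{n-1}(d)&\mathsf W_{n-1}^{(2)}&\mathsf W_{n-1}^{(3)}&P_{n-1}(x)\\P_{n}(d)&\mathsf W_{n}^{(2)}&\mathsf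 W_{n}^{(3)}&P_{n}(x)\\P_{n+1}(d)&\mathsf W_{n+1}^{(2)}&\mathsf W_{n+1}^{(3)}&P_{n+1}(x)\end{vmatrix}.$$ -/

import Mathlib

open Polynomial MeasureTheory

noncomputable section

namespace StepLine

/- Multiple orthogonality on the step line for a row of three (possibly complex) measures.
The row `(dν₁, dν₂, dν₃)` enters through its integrals of polynomials, `𝓛 a f = ∫ f dν_{a+1}`. -/

/-- The component `n_{a+1}` of the step-line multi-index `(n₁, n₂, n₃)` of size `n`, that is
`(0,0,0), (1,0,0), (1,1,0), (1,1,1), (2,1,1), …`. -/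
def idx (n : ℕ) (a : Fin 3) : ℕ := (n + 2 - (a : ℕ)) / 3

/-- The leading principal `k × k` submatrix of the moment matrix `∫ X_{[1]} dν X_{[3]}ᵀ`: the
column `j = 3 m + a` carries the monomial `x ^ m` in the measure `ν_{a+1}`. -/
def momentMatrix (𝓛 : Fin 3 → ℂ[X] → ℂ) (k : ℕ) : Matrix (Fin k) (Fin k) ℂ :=
  Matrix.of fun i j => 𝓛 (Fin.ofNat 3 (j : ℕ)) (X ^ ((i : ℕ) + (j : ℕ) / 3))

/-- Existence of the orthogonality (of the Gauss–Borel factorization): all the leading principal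
submatrices of the moment matrix are invertible. -/
def HasOrthogonality (𝓛 : Fin 3 → ℂ[X] → ℂ) : Prop :=
  ∀ k : ℕ, (momentMatrix 𝓛 k).det ≠ 0

/-- `B` is a monic type II polynomial of degree `n`. -/
structure IsTypeII (𝓛 : Fin 3 → ℂ[X] → ℂ) (n : ℕ) (B : ℂ[X]) : Prop where
  monic : B.Monic
  natDegree_eq : B.natDegree = n
  orth : ∀ a : Fin 3, ∀ l < idx n a, 𝓛 a (X ^ l * B) = 0

/-- `(A 0, A 1, A 2)` is the vector of type I polynomials `(A_n^{(1)}, A_n^{(2)}, A_n^{(3)})`, in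
the enumeration that is biorthogonal to the type II polynomials,
`∑ a, ∫ B_m A_n^{(a)} dν_a = δ_{m,n}`; its multi-index has size `n + 1`. -/
structure IsTypeI (𝓛 : Fin 3 → ℂ[X] → ℂ) (n : ℕ) (A : Fin 3 → ℂ[X]) : Prop where
  degree_lt : ∀ a : Fin 3, (A a).degree < (idx (n + 1) a : WithBot ℕ)
  orth : ∀ l < n, ∑ a, 𝓛 a (X ^ l * A a) = 0
  normalized : ∑ a, 𝓛 a (X ^ n * A a) = 1

open Classical in
/-- The monic type II polynomial of degree `n` (when orthogonality exists). -/
def typeII (𝓛 : Fin 3 → ℂ[X] → ℂ) (n : ℕ) : ℂ[X] :=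
  if h : ∃ B, IsTypeII 𝓛 n B then h.choose else 0

open Classical in
/-- The `n`-th vector of type I polynomials (when orthogonality exists). -/
def typeI (𝓛 : Fin 3 → ℂ[X] → ℂ) (n : ℕ) : Fin 3 → ℂ[X] :=
  if h : ∃ A, IsTypeI 𝓛 n A then h.choose else 0

end StepLine

namespace JacobiPineiro

/-- The measure `x ^ α (1 - x) ^ β dx` on `[0, 1]`. -/
def meas (α β : ℝ) : Measure ℝ :=
  (volume.restrict (Set.Icc 0 1)).withDensity fun x => ENNReal.ofReal (x ^ α * (1 - x) ^ β)

/-- The Jacobi–Piñeiro row of measures, through its integrals. -/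
def functional (α : Fin 3 → ℝ) (β : ℝ) (a : Fin 3) (f : ℂ[X]) : ℂ :=
  ∫ x : ℝ, f.eval (x : ℂ) ∂(meas (α a) β)

/-- Type II Jacobi–Piñeiro polynomials on the step line. -/
def P (α : Fin 3 → ℝ) (β : ℝ) (n : ℕ) : ℂ[X] := StepLine.typeII (functional α β) n

/-- Type I Jacobi–Piñeiro polynomials on the step line; `PI α β n a` is `P_n^{(a+1)}`. -/
def PI (α : Fin 3 → ℝ) (β : ℝ) (n : ℕ) (a : Fin 3) : ℂ[X] :=
  StepLine.typeI (functional α β) n a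

/-- The Cauchy transform `D_n^{(a+1)}(z) = ∫ P_n(x) / (z - x) dμ_{a+1}(x)`. -/
def D (α : Fin 3 → ℝ) (β : ℝ) (n : ℕ) (a : Fin 3) (z : ℂ) : ℂ :=
  ∫ x : ℝ, (P α β n).eval (x : ℂ) / (z - (x : ℂ)) ∂(meas (α a) β)

/-- The matrix polynomial `P₂`. -/
def P₂ (c : ℝ) : Matrix (Fin 3) (Fin 3) ℂ[X] :=
  !![0, C (c : ℂ) - X, 0;
     0, 0, C (c : ℂ) - X;
     1, 0, 0]

/-- The perturbed row of measures `dμ̃₂`, through its integrals: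
`(x-d)/(c-x) dμ₂ + (c-d) ξ₁(c) δ_c`, `(x-d)/(c-x) dμ₃ + (c-d) ξ₂(c) δ_c`, `(x-d) dμ₁`. -/
def perturbed (α : Fin 3 → ℝ) (β c d : ℝ) (ξ₁ ξ₂ : ℝ → ℂ) (a : Fin 3) (f : ℂ[X]) : ℂ :=
  ![(∫ x : ℝ, f.eval (x : ℂ) * (((x : ℂ) - d) / ((c : ℂ) - x)) ∂(meas (α 1) β))
      + ((c : ℂ) - d) * ξ₁ c * f.eval (c : ℂ),
    (∫ x : ℝ, f.eval (x : ℂ) * (((x : ℂ) - d) / ((c : ℂ) - x)) ∂(meas (α 2) β))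
      + ((c : ℂ) - d) * ξ₂ c * f.eval (c : ℂ),
    ∫ x : ℝ, f.eval (x : ℂ) * ((x : ℂ) - d) ∂(meas (α 0) β)] a

/-- The defining relation `dμ̃₂ P₂ = (x - d) dμ`. -/
theorem perturbed_mul_P₂ (α : Fin 3 → ℝ) (β c d : ℝ) (ξ₁ ξ₂ : ℝ → ℂ) (a : Fin 3) (f : ℂ[X]) :
    ∑ b, perturbed α β c d ξ₁ ξ₂ b (f * P₂ c b a) =
      functional α β a ((X - C (d : ℂ)) * f) := by
  have key : ∀ e : ℝ, (∫ x : ℝ, (f * (C (c : ℂ) - X)).eval (x : ℂ) *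
      (((x : ℂ) - d) / ((c : ℂ) - x)) ∂(meas e β)) =
      ∫ x : ℝ, ((X - C (d : ℂ)) * f).eval (x : ℂ) ∂(meas e β) := by
    intro e
    apply integral_congr_ae
    have hac : meas e β ≪ volume :=
      (withDensity_absolutelyContinuous _ _).trans Measure.restrict_le_self.absolutelyContinuous
    have h0 : ∀ᵐ x ∂(meas e β), x ≠ c := by
      have h1 : ∀ᵐ x : ℝ, x ≠ c := by rw [ae_iff]; simp
      exact hac.ae_le h1
    filter_upwards [h0] with x hx
    have hx' : (c : ℂ) - x ≠ 0 := sub_ne_zero.mpr (by exact_mod_cast hx.symm)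
    simp only [eval_mul, eval_sub, eval_C, eval_X]
    field_simp
  fin_cases a
  · simp [perturbed, P₂, functional, Fin.sum_univ_three, mul_comm]
  · have := key (α 1)
    simp [perturbed, P₂, functional, Fin.sum_univ_three] at this ⊢
    exact this
  · have := key (α 2)
    simp [perturbed, P₂, functional, Fin.sum_univ_three] at this ⊢
    exact this

/-- Type II polynomials of the perturbed measures. -/
def Pt (α : Fin 3 → ℝ) (β c d : ℝ) (ξ₁ ξ₂ : ℝ → ℂ) (n : ℕ) : ℂ[X] :=
  StepLine.typeII (perturbed α β c d ξ₁ ξ₂) n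

/-- Type I polynomials of the perturbed measures. -/
def PtI (α : Fin 3 → ℝ) (β c d : ℝ) (ξ₁ ξ₂ : ℝ → ℂ) (n : ℕ) (a : Fin 3) : ℂ[X] :=
  StepLine.typeI (perturbed α β c d ξ₁ ξ₂) n a

/-- `D_k^{(2)}(c) + ξ₁(c) P_k(c)`. -/
def W₂ (α : Fin 3 → ℝ) (β c : ℝ) (ξ₁ : ℝ → ℂ) (k : ℕ) : ℂ :=
  D α β k 1 (c : ℂ) + ξ₁ c * (P α β k).eval (c : ℂ)

/-- `D_k^{(3)}(c) + ξ₂(c) P_k(c)`. -/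
def W₃ (α : Fin 3 → ℝ) (β c : ℝ) (ξ₂ : ℝ → ℂ) (k : ℕ) : ℂ :=
  D α β k 2 (c : ℂ) + ξ₂ c * (P α β k).eval (c : ℂ)

/-- The `3 × 3` determinant with rows `(P_k(d), W₂ k, W₃ k)` for the three indices `k` given. -/
def det₃ (α : Fin 3 → ℝ) (β c d : ℝ) (ξ₁ ξ₂ : ℝ → ℂ) (i j k : ℕ) : ℂ :=
  Matrix.det
    !![(P α β i).eval (d : ℂ), W₂ α β c ξ₁ i, W₃ α β c ξ₂ i;
       (P α β j).eval (d : ℂ), W₂ α β c ξ₁ j, W₃ α β c ξ₂ j;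
       (P α β k).eval (d : ℂ), W₂ α β c ξ₁ k, W₃ α β c ξ₂ k]

/-- The determinant `τ_n`, for `n ≥ 2`. -/
def τ (α : Fin 3 → ℝ) (β c d : ℝ) (ξ₁ ξ₂ : ℝ → ℂ) (n : ℕ) : ℂ :=
  det₃ α β c d ξ₁ ξ₂ (n - 2) (n - 1) n

end JacobiPineiro

end

open JacobiPineiro

noncomputable section

/-! ### Combinatorics of the step line and coefficient expansions. -/

namespace StepLine

/-! Let `u 0` be `f ↦ ∫ f/(c-x) dμ₂ + ξ₁(c) f(c)`, let `u 1` be the same with `μ₃` and `ξ₂`, and let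
`u 2` be integration against `μ₁`. Multiplication by `c-x` kills the masses at `c`, so `dμ` is the
row `(u 2, (c-x) u 0, (c-x) u 1)` (`base`), the perturbed row is `(x-d) u` (`shifted`), and the
numbers `W₂`, `W₃` at `k` are `u 0` and `u 1` of `P_k`. The rest is algebra of linear functionals.

Put `Q = (x-d) R`. Orthogonality of `R` to the perturbed row at size `k+2` amounts to orthogonality
of `Q` to `dμ` at size `k` together with `u 0 Q = u 1 Q = 0`. By biorthogonality such a `Q` is a
combination of `P_k, P_{k+1}, …` subject to three linear conditions: `Q(d) = 0`, `u 0 Q = 0`, `u 1 Q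
= 0`. On the span of three consecutive `P`'s only `Q = 0` satisfies them, hence `τ ≠ 0`
(`tri_ne_zero`); with a fourth, monic one, the solution is `(x-d)` times the perturbed type II
polynomial (`eval_typeII_eq`).

For type I, the claimed row is tested against the definition (`isTypeI_christoffelRow`) and
uniqueness (`IsTypeI.eq`) finishes. Orthogonality for `dμ` itself (`hasOrthogonality`) comes from
the moments being beta values at distinct points. -/

theorem lt_idx_iff {k l : ℕ} {a : Fin 3} : l < idx k a ↔ 3 * l + (a : ℕ) < k := by
  have := a.isLt
  unfold idx
  omega

theorem idx_mono {m n : ℕ} (h : m ≤ n) (a : Fin 3) : idx m a ≤ idx n a := by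
  unfold idx
  omega

theorem idx_succ_self (k : ℕ) : idx (k + 1) (Fin.ofNat 3 k) = idx k (Fin.ofNat 3 k) + 1 := by
  simp only [idx, Fin.ofNat]
  omega

theorem idx_self (k : ℕ) : idx k (Fin.ofNat 3 k) = k / 3 := by
  simp only [idx, Fin.ofNat]
  omega

theorem idx_succ_of_ne {k : ℕ} {a : Fin 3} (h : a ≠ Fin.ofNat 3 k) : idx (k + 1) a = idx k a := by
  have h' : (a : ℕ) ≠ k % 3 := fun e => h (Fin.ext e)
  have := a.isLt
  simp only [idx]
  omega

theorem div_three_lt_idx {j k : ℕ} (h : j < k) : j / 3 < idx k (Fin.ofNat 3 j) := by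
  rw [lt_idx_iff]
  simp only [Fin.ofNat]
  omega

/-- Summation along the step line is summation over the three components. -/
theorem sum_range_eq_sum_idx {M : Type*} [AddCommMonoid M] (g : Fin 3 → ℕ → M) (k : ℕ) :
    ∑ j ∈ Finset.range k, g (Fin.ofNat 3 j) (j / 3) =
      ∑ a, ∑ l ∈ Finset.range (idx k a), g a l := by
  induction k with
  | zero => simp [Fin.sum_univ_three, idx]
  | succ k ih =>
    -- Passing from size `k` to `k + 1` enlarges only the component `k mod 3`, by the index `k / 3`.
    rw [Finset.sum_range_succ, ih, ← Finset.add_sum_erase _ _ (Finset.mem_univ (Fin.ofNat 3 k)),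
      ← Finset.add_sum_erase _ (fun a => ∑ l ∈ Finset.range (idx (k + 1) a), g a l)
        (Finset.mem_univ (Fin.ofNat 3 k)), idx_succ_self, Finset.sum_range_succ, idx_self,
      add_right_comm]
    congr 1
    refine Finset.sum_congr rfl fun a ha => ?_
    rw [idx_succ_of_ne (Finset.ne_of_mem_erase ha)]

theorem eq_sum_range_of_degree_lt {p : ℂ[X]} {k : ℕ} (hp : p.degree < k) :
    p = ∑ i ∈ Finset.range k, p.coeff i • X ^ i := by
  ext m
  simp only [finsetSum_coeff, coeff_smul, coeff_X_pow, smul_eq_mul, mul_ite, mul_one, mul_zero,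
    Finset.sum_ite_eq, Finset.mem_range]
  split_ifs with h
  · rfl
  · exact coeff_eq_zero_of_degree_lt (hp.trans_le (by exact_mod_cast not_lt.1 h))

theorem degree_sum_range_lt (k : ℕ) (v : ℕ → ℂ) :
    (∑ i ∈ Finset.range k, v i • (X : ℂ[X]) ^ i).degree < k := by
  rw [degree_lt_iff_coeff_zero]
  intro m hm
  simp only [finsetSum_coeff, coeff_smul, coeff_X_pow, smul_eq_mul, mul_ite, mul_one, mul_zero,
    Finset.sum_ite_eq, Finset.mem_range]
  rw [if_neg (not_lt.2 hm)]

theorem coeff_sum_range (k : ℕ) (v : ℕ → ℂ) {m : ℕ} (hm : m < k) :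
    (∑ i ∈ Finset.range k, v i • (X : ℂ[X]) ^ i).coeff m = v m := by
  simp [coeff_X_pow, hm]

variable {L : Fin 3 → ℂ[X] →ₗ[ℂ] ℂ}

theorem map_mul_eq_sum (u : ℂ[X] →ₗ[ℂ] ℂ) {p : ℂ[X]} {k : ℕ} (hp : p.degree < k) (q : ℂ[X]) :
    u (q * p) = ∑ i ∈ Finset.range k, p.coeff i * u (q * X ^ i) := by
  conv_lhs => rw [eq_sum_range_of_degree_lt hp]
  simp [Finset.mul_sum, map_sum]

/-- The pairing with a row of polynomials in terms of its coefficients. -/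
theorem sum_map_mul_eq {A : Fin 3 → ℂ[X]} {k : ℕ} (hA : ∀ a, (A a).degree < idx k a) (q : ℂ[X]) :
    ∑ a, L a (q * A a) =
      ∑ j ∈ Finset.range k, (A (Fin.ofNat 3 j)).coeff (j / 3) *
        L (Fin.ofNat 3 j) (q * X ^ (j / 3)) := by
  rw [sum_range_eq_sum_idx (fun a l => (A a).coeff l * L a (q * X ^ l))]
  exact Finset.sum_congr rfl fun a _ => map_mul_eq_sum _ (hA a) q

/-! ### Existence and uniqueness of both families from the moment matrix. -/

theorem momentMatrix_mulVec (k : ℕ) (v : ℕ → ℂ) (i : Fin k) :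
    (momentMatrix (fun a => L a) k).mulVec (fun j : Fin k => v j) i =
      ∑ j ∈ Finset.range k, v j * L (Fin.ofNat 3 j) (X ^ (i : ℕ) * X ^ (j / 3)) := by
  rw [← Fin.sum_univ_eq_sum_range
    (fun j => v j * L (Fin.ofNat 3 j) (X ^ (i : ℕ) * X ^ (j / 3)))]
  simp [Matrix.mulVec, dotProduct, momentMatrix, mul_comm, pow_add]

theorem momentMatrix_vecMul (k : ℕ) (v : ℕ → ℂ) (j : Fin k) :
    (Matrix.vecMul (fun i : Fin k => v i) (momentMatrix (fun a => L a) k)) j =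
      ∑ i ∈ Finset.range k, v i * L (Fin.ofNat 3 j) (X ^ ((j : ℕ) / 3) * X ^ i) := by
  rw [← Fin.sum_univ_eq_sum_range
    (fun i => v i * L (Fin.ofNat 3 j) (X ^ ((j : ℕ) / 3) * X ^ i))]
  simp [Matrix.vecMul, dotProduct, momentMatrix, mul_comm, pow_add]

/-- The coefficient vector of `R` lies in the left kernel of the moment matrix. For type I rows,
below, the right kernel plays this role. -/
theorem eq_zero_of_degree_lt_of_orth (h : HasOrthogonality fun a => L a) {k : ℕ} {R : ℂ[X]}
    (hR : R.degree < k) (ho : ∀ a, ∀ l < idx k a, L a (X ^ l * R) = 0) : R = 0 := by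
  have h0 : (fun i : Fin k => R.coeff i) = 0 := by
    refine Matrix.eq_zero_of_vecMul_eq_zero (h k) ?_
    ext j
    rw [momentMatrix_vecMul k R.coeff, ← map_mul_eq_sum _ hR]
    exact ho _ _ (div_three_lt_idx j.isLt)
  rw [eq_sum_range_of_degree_lt hR]
  refine Finset.sum_eq_zero fun i hi => ?_
  have := congrFun h0 ⟨i, Finset.mem_range.1 hi⟩
  simp only [Pi.zero_apply] at this
  rw [this, zero_smul]

theorem row_eq_zero_of_orth (h : HasOrthogonality fun a => L a) {k : ℕ} {A : Fin 3 → ℂ[X]}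
    (hA : ∀ a, (A a).degree < idx k a) (ho : ∀ l < k, ∑ a, L a (X ^ l * A a) = 0) : A = 0 := by
  have h0 : (fun j : Fin k => (A (Fin.ofNat 3 j)).coeff ((j : ℕ) / 3)) = 0 := by
    refine Matrix.eq_zero_of_mulVec_eq_zero (h k) ?_
    ext i
    rw [momentMatrix_mulVec k fun j => (A (Fin.ofNat 3 j)).coeff (j / 3), ← sum_map_mul_eq hA]
    exact ho i i.isLt
  funext a
  rw [eq_sum_range_of_degree_lt (hA a)]
  refine Finset.sum_eq_zero fun l hl => ?_
  have hl' := lt_idx_iff.1 (Finset.mem_range.1 hl)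
  have := congrFun h0 ⟨3 * l + a, hl'⟩
  have ha : Fin.ofNat 3 (3 * l + (a : ℕ)) = a := Fin.ext (by simp only [Fin.ofNat]; omega)
  have hd : (3 * l + (a : ℕ)) / 3 = l := by omega
  simp only [Pi.zero_apply, ha, hd] at this
  rw [this, zero_smul]

theorem exists_isTypeII (h : HasOrthogonality fun a => L a) (n : ℕ) :
    ∃ B, IsTypeII (fun a => L a) n B := by
  have hu : IsUnit (momentMatrix (fun a => L a) n) :=
    (Matrix.isUnit_iff_isUnit_det _).2 (h n).isUnit
  -- The lower coefficients must cancel the moments contributed by the leading term `X ^ n`.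
  obtain ⟨w, hw⟩ := (Matrix.vecMul_surjective_iff_isUnit.2 hu)
    fun j => - L (Fin.ofNat 3 j) (X ^ ((j : ℕ) / 3) * X ^ n)
  let v : ℕ → ℂ := fun i => if hi : i < n then w ⟨i, hi⟩ else 0
  have hv : w = fun i : Fin n => v i := by ext i; simp only [v, dif_pos i.isLt]
  set R : ℂ[X] := ∑ i ∈ Finset.range n, v i • X ^ i with hRdef
  have hR : R.degree < n := degree_sum_range_lt n v
  refine ⟨X ^ n + R, monic_X_pow_add hR, ?_, ?_⟩
  · exact natDegree_eq_of_degree_eq_some <| by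
      rw [degree_add_eq_left_of_degree_lt (by rwa [degree_X_pow]), degree_X_pow]
  · intro a l hl
    have hl' := lt_idx_iff.1 hl
    have ha : Fin.ofNat 3 (3 * l + (a : ℕ)) = a := Fin.ext (by simp only [Fin.ofNat]; omega)
    have hd : (3 * l + (a : ℕ)) / 3 = l := by omega
    have := congrFun hw ⟨3 * l + a, hl'⟩
    rw [hv] at this
    dsimp only at this
    rw [momentMatrix_vecMul n v] at this
    simp only [ha, hd] at this
    rw [mul_add, map_add, map_mul_eq_sum _ hR]
    rw [Finset.sum_congr rfl fun i hi => by
      rw [hRdef, coeff_sum_range n v (Finset.mem_range.1 hi)], this]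
    ring

theorem exists_isTypeI (h : HasOrthogonality fun a => L a) (n : ℕ) :
    ∃ A, IsTypeI (fun a => L a) n A := by
  have hu : IsUnit (momentMatrix (fun a => L a) (n + 1)) :=
    (Matrix.isUnit_iff_isUnit_det _).2 (h (n + 1)).isUnit
  obtain ⟨w, hw⟩ := (Matrix.mulVec_surjective_iff_isUnit.2 hu)
    fun i => if (i : ℕ) = n then 1 else 0
  let v : ℕ → ℂ := fun i => if hi : i < n + 1 then w ⟨i, hi⟩ else 0
  have hv : w = fun i : Fin (n + 1) => v i := by ext i; simp only [v, dif_pos i.isLt]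
  set A : Fin 3 → ℂ[X] := fun a =>
    ∑ l ∈ Finset.range (idx (n + 1) a), v (3 * l + a) • X ^ l with hAdef
  have hA : ∀ a, (A a).degree < idx (n + 1) a := fun a =>
    degree_sum_range_lt _ fun l => v (3 * l + a)
  have key : ∀ l < n + 1, ∑ a, L a (X ^ l * A a) = if l = n then 1 else 0 := by
    intro l hl
    have := congrFun hw ⟨l, hl⟩
    rw [hv, momentMatrix_mulVec (n + 1) v] at this
    rw [sum_map_mul_eq hA, ← this]
    refine Finset.sum_congr rfl fun j hj => ?_
    congr 1
    rw [hAdef]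
    simp only
    rw [coeff_sum_range _ (fun l => v (3 * l + (Fin.ofNat 3 j : Fin 3)))
      (div_three_lt_idx (Finset.mem_range.1 hj))]
    congr 1
    simp only [Fin.ofNat]
    omega
  refine ⟨A, hA, fun l hl => ?_, ?_⟩
  · simpa [hl.ne] using key l (by omega)
  · simpa using key n (by omega)

theorem isTypeII_typeII (h : HasOrthogonality fun a => L a) (n : ℕ) :
    IsTypeII (fun a => L a) n (typeII (fun a => L a) n) := by
  rw [typeII, dif_pos (exists_isTypeII h n)]
  exact (exists_isTypeII h n).choose_spec

theorem isTypeI_typeI (h : HasOrthogonality fun a => L a) (n : ℕ) :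
    IsTypeI (fun a => L a) n (typeI (fun a => L a) n) := by
  rw [typeI, dif_pos (exists_isTypeI h n)]
  exact (exists_isTypeI h n).choose_spec

theorem IsTypeI.eq (h : HasOrthogonality fun a => L a) {n : ℕ} {A A' : Fin 3 → ℂ[X]}
    (hA : IsTypeI (fun a => L a) n A) (hA' : IsTypeI (fun a => L a) n A') : A = A' := by
  rw [← sub_eq_zero]
  refine row_eq_zero_of_orth h (k := n + 1)
    (fun a => (degree_sub_le _ _).trans_lt (max_lt (hA.degree_lt a) (hA'.degree_lt a))) ?_
  intro l hl
  simp only [Pi.sub_apply, mul_sub, map_sub, Finset.sum_sub_distrib]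
  rcases Nat.lt_succ_iff_lt_or_eq.1 hl with hl | rfl
  · rw [hA.orth l hl, hA'.orth l hl, sub_zero]
  · rw [hA.normalized, hA'.normalized, sub_self]

/-! ### Biorthogonality and the resulting expansion. -/

/-- The linear functional `f ↦ ∑ a, ∫ f A_a dν_a`. -/
def pairing (L : Fin 3 → ℂ[X] →ₗ[ℂ] ℂ) (A : Fin 3 → ℂ[X]) : ℂ[X] →ₗ[ℂ] ℂ :=
  ∑ a, L a ∘ₗ LinearMap.mulRight ℂ (A a)

theorem pairing_apply (A : Fin 3 → ℂ[X]) (f : ℂ[X]) :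
    pairing L A f = ∑ a, L a (f * A a) := by
  simp [pairing]

/-- A type I row annihilates what is orthogonal with respect to its multi-index. -/
theorem IsTypeI.pairing_eq_zero {n : ℕ} {A : Fin 3 → ℂ[X]} (hA : IsTypeI (fun a => L a) n A)
    {Q : ℂ[X]} (hQ : ∀ a, ∀ l < idx (n + 1) a, L a (X ^ l * Q) = 0) : pairing L A Q = 0 := by
  rw [pairing_apply]
  refine Finset.sum_eq_zero fun a _ => ?_
  rw [map_mul_eq_sum _ (hA.degree_lt a)]
  refine Finset.sum_eq_zero fun l hl => ?_
  rw [mul_comm Q, hQ a l (Finset.mem_range.1 hl), mul_zero]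

theorem IsTypeI.pairing_eq_coeff {n : ℕ} {A : Fin 3 → ℂ[X]} (hA : IsTypeI (fun a => L a) n A)
    {f : ℂ[X]} (hf : f.degree < ((n + 1 : ℕ) : WithBot ℕ)) : pairing L A f = f.coeff n := by
  have := map_mul_eq_sum (pairing L A) hf 1
  rw [one_mul] at this
  rw [this, Finset.sum_range_succ, Finset.sum_eq_zero, zero_add, one_mul, pairing_apply,
    hA.normalized, mul_one]
  intro i hi
  rw [one_mul, pairing_apply, hA.orth i (Finset.mem_range.1 hi), mul_zero]

theorem IsTypeII.degree_lt {n k : ℕ} {B : ℂ[X]} (hB : IsTypeII (fun a => L a) n B) (h : n < k) :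
    B.degree < k := by
  rw [degree_eq_natDegree hB.monic.ne_zero, hB.natDegree_eq]
  exact_mod_cast h

theorem pairing_biorthogonal {n m : ℕ} {A : Fin 3 → ℂ[X]} {B : ℂ[X]}
    (hA : IsTypeI (fun a => L a) n A) (hB : IsTypeII (fun a => L a) m B) :
    pairing L A B = if m = n then 1 else 0 := by
  rcases lt_trichotomy m n with h | rfl | h
  · rw [hA.pairing_eq_coeff (hB.degree_lt (by omega)), if_neg h.ne,
      coeff_eq_zero_of_degree_lt (hB.degree_lt h)]
  · rw [hA.pairing_eq_coeff (hB.degree_lt (by omega)), if_pos rfl]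
    simpa [hB.natDegree_eq] using hB.monic.coeff_natDegree
  · rw [if_neg h.ne']
    exact hA.pairing_eq_zero fun a l hl => hB.orth a l (hl.trans_le (idx_mono h a))

theorem exists_eq_sum_typeII {B : ℕ → ℂ[X]} (hB : ∀ n, IsTypeII (fun a => L a) n (B n)) (k : ℕ)
    (f : ℂ[X]) (hf : f.degree < k) : ∃ v : ℕ → ℂ, f = ∑ i ∈ Finset.range k, v i • B i := by
  induction k generalizing f with
  | zero => exact ⟨0, by simpa using hf⟩
  | succ k ih =>
    obtain ⟨v, hv⟩ := ih (f - f.coeff k • B k) (by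
      rw [degree_lt_iff_coeff_zero] at hf ⊢
      intro m hm
      rcases hm.eq_or_lt with rfl | hm
      · have := (hB k).monic.coeff_natDegree
        rw [(hB k).natDegree_eq] at this
        simp [this]
      · rw [coeff_sub, hf m hm, coeff_smul,
          coeff_eq_zero_of_degree_lt ((hB k).degree_lt hm)]
        simp)
    refine ⟨Function.update v k (f.coeff k), ?_⟩
    rw [Finset.sum_range_succ, Function.update_self, ← sub_eq_iff_eq_add, hv]
    refine Finset.sum_congr rfl fun i hi => ?_
    rw [Function.update_of_ne (Finset.mem_range.1 hi).ne]

/-- The biorthogonal expansion. -/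
theorem eq_sum_pairing_smul {A : ℕ → Fin 3 → ℂ[X]} {B : ℕ → ℂ[X]}
    (hA : ∀ n, IsTypeI (fun a => L a) n (A n)) (hB : ∀ n, IsTypeII (fun a => L a) n (B n))
    {k : ℕ} {f : ℂ[X]} (hf : f.degree < k) :
    f = ∑ i ∈ Finset.range k, pairing L (A i) f • B i := by
  obtain ⟨v, hv⟩ := exists_eq_sum_typeII hB k f hf
  conv_lhs => rw [hv]
  refine Finset.sum_congr rfl fun i hi => ?_
  congr 1
  rw [hv, map_sum]
  simp [pairing_biorthogonal (hA i) (hB _), Finset.mem_range.1 hi]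

end StepLine

/-! ### The Christoffel–Geronimus transformation of a row of functionals. -/

namespace StepLine

/-- The row of functionals that the Christoffel–Geronimus transformation starts from. -/
def base (u : Fin 3 → ℂ[X] →ₗ[ℂ] ℂ) (c : ℂ) : Fin 3 → ℂ[X] →ₗ[ℂ] ℂ :=
  ![u 2, u 0 ∘ₗ LinearMap.mulLeft ℂ (C c - X), u 1 ∘ₗ LinearMap.mulLeft ℂ (C c - X)]

/-- The row of functionals multiplied by `X - d`. -/
def shifted (u : Fin 3 → ℂ[X] →ₗ[ℂ] ℂ) (d : ℂ) (a : Fin 3) : ℂ[X] →ₗ[ℂ] ℂ :=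
  u a ∘ₗ LinearMap.mulLeft ℂ (X - C d)

variable {u : Fin 3 → ℂ[X] →ₗ[ℂ] ℂ} {c d : ℂ}

theorem base_zero (f : ℂ[X]) : base u c 0 f = u 2 f := rfl

theorem base_one (f : ℂ[X]) : base u c 1 f = u 0 ((C c - X) * f) := rfl

theorem base_two (f : ℂ[X]) : base u c 2 f = u 1 ((C c - X) * f) := rfl

theorem shifted_apply (a : Fin 3) (f : ℂ[X]) : shifted u d a f = u a ((X - C d) * f) := rfl

theorem map_C_sub_X_mul_X_pow (w : ℂ[X] →ₗ[ℂ] ℂ) (c : ℂ) (l : ℕ) (Q : ℂ[X]) :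
    w ((C c - X) * (X ^ l * Q)) = c * w (X ^ l * Q) - w (X ^ (l + 1) * Q) := by
  rw [← smul_eq_mul c, ← map_smul, ← map_sub, smul_eq_C_mul]
  congr 1
  ring

/-- The shift by two is `idx (k+2) 0 = idx k 1 + 1`, `idx (k+2) 1 = idx k 2 + 1`, `idx (k+2) 2 = idx
k 0`; the factor `c - X` uses up the one extra condition in each of the first two components. -/
theorem base_orth_of_shifted_orth {k : ℕ} {R : ℂ[X]}
    (h : ∀ a, ∀ l < idx (k + 2) a, shifted u d a (X ^ l * R) = 0) :
    ∀ a, ∀ l < idx k a, base u c a (X ^ l * ((X - C d) * R)) = 0 := by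
  have h' : ∀ a, ∀ l < idx (k + 2) a, u a (X ^ l * ((X - C d) * R)) = 0 := fun a l hl => by
    rw [mul_left_comm]
    exact h a l hl
  intro a l hl
  rw [lt_idx_iff] at hl
  fin_cases a
  · exact h' 2 l (lt_idx_iff.2 (by simp at hl ⊢; omega))
  · simp only [Fin.mk_one, base_one, map_C_sub_X_mul_X_pow]
    rw [h' 0 l (lt_idx_iff.2 (by simp at hl ⊢; omega)),
      h' 0 (l + 1) (lt_idx_iff.2 (by simp at hl ⊢; omega)), mul_zero, sub_zero]
  · simp only [Fin.reduceFinMk, base_two, map_C_sub_X_mul_X_pow]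
    rw [h' 1 l (lt_idx_iff.2 (by simp at hl ⊢; omega)),
      h' 1 (l + 1) (lt_idx_iff.2 (by simp at hl ⊢; omega)), mul_zero, sub_zero]

/-- Removing the factor `c - X` gives a first-order recursion in `l` for `w (X ^ l * Q)`; the
initial value `w Q = 0` is the extra datum it needs. -/
theorem map_X_pow_mul_eq_zero {w : ℂ[X] →ₗ[ℂ] ℂ} {Q : ℂ[X]} {m : ℕ} (h0 : w Q = 0)
    (h : ∀ l, l + 1 < m → w ((C c - X) * (X ^ l * Q)) = 0) : ∀ l < m, w (X ^ l * Q) = 0 := by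
  intro l
  induction l with
  | zero => simpa using fun _ => h0
  | succ l ih =>
    intro hl
    have := h l hl
    rwa [map_C_sub_X_mul_X_pow, ih (by omega), mul_zero, zero_sub, neg_eq_zero] at this

theorem shifted_orth_of_base_orth {k : ℕ} {R : ℂ[X]} (h0 : u 0 ((X - C d) * R) = 0)
    (h1 : u 1 ((X - C d) * R) = 0)
    (h : ∀ a, ∀ l < idx k a, base u c a (X ^ l * ((X - C d) * R)) = 0) :
    ∀ a, ∀ l < idx (k + 2) a, shifted u d a (X ^ l * R) = 0 := by
  intro a l hl
  rw [shifted_apply, mul_left_comm]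
  fin_cases a
  · refine map_X_pow_mul_eq_zero (c := c) h0 (fun l hl => h 1 l ?_) l hl
    rw [lt_idx_iff] at hl ⊢
    simp at hl ⊢
    omega
  · refine map_X_pow_mul_eq_zero (c := c) h1 (fun l hl => h 2 l ?_) l hl
    rw [lt_idx_iff] at hl ⊢
    simp at hl ⊢
    omega
  · refine h 0 l ?_
    rw [lt_idx_iff] at hl ⊢
    simp at hl ⊢
    omega

/-! ### Determinantal formulas for the transformed polynomials. -/

/-- The determinant with rows `(B_m(d), u₀ B_m, u₁ B_m)`. -/
def tri (u : Fin 3 → ℂ[X] →ₗ[ℂ] ℂ) (d : ℂ) (B : ℕ → ℂ[X]) (i j k : ℕ) : ℂ :=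
  Matrix.det
    !![(B i).eval d, u 0 (B i), u 1 (B i);
       (B j).eval d, u 0 (B j), u 1 (B j);
       (B k).eval d, u 0 (B k), u 1 (B k)]

variable {L : Fin 3 → ℂ[X] →ₗ[ℂ] ℂ} {A : ℕ → Fin 3 → ℂ[X]} {B : ℕ → ℂ[X]}

theorem eq_sum_pairing_of_orth (hA : ∀ n, IsTypeI (fun a => L a) n (A n))
    (hB : ∀ n, IsTypeII (fun a => L a) n (B n)) {k m : ℕ} {Q : ℂ[X]} (hQ : Q.degree < (k + m : ℕ))
    (ho : ∀ a, ∀ l < idx k a, L a (X ^ l * Q) = 0) :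
    Q = ∑ i ∈ Finset.range m, pairing L (A (k + i)) Q • B (k + i) := by
  conv_lhs => rw [eq_sum_pairing_smul hA hB hQ]
  rw [Finset.sum_range_add, Finset.sum_eq_zero, zero_add]
  intro i hi
  rw [(hA i).pairing_eq_zero fun a l hl =>
    ho a l (hl.trans_le (idx_mono (Finset.mem_range.1 hi) a)), zero_smul]

/-- A left kernel vector gives a combination `Q` of three consecutive type II polynomials with `Q(d)
= u 0 Q = u 1 Q = 0`. Its quotient by `X - d` has degree below `k + 2` and is orthogonal to the
transformed row at that size, so it vanishes. -/
theorem tri_ne_zero (hT : HasOrthogonality fun a => shifted u d a)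
    (hA : ∀ n, IsTypeI (fun a => base u c a) n (A n))
    (hB : ∀ n, IsTypeII (fun a => base u c a) n (B n)) (k : ℕ) :
    tri u d B k (k + 1) (k + 2) ≠ 0 := by
  intro h0
  obtain ⟨w, hw0, hw⟩ := Matrix.exists_vecMul_eq_zero_iff.2 h0
  set Q : ℂ[X] := ∑ i : Fin 3, w i • B (k + i) with hQ
  have e0 := congrFun hw 0
  have e1 := congrFun hw 1
  have e2 := congrFun hw 2
  simp [Matrix.vecMul, dotProduct, Fin.sum_univ_three] at e0 e1 e2
  have hd : Q.eval d = 0 := by simpa [hQ, Fin.sum_univ_three] using e0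
  have h0 : u 0 Q = 0 := by simpa [hQ, Fin.sum_univ_three] using e1
  have h1 : u 1 Q = 0 := by simpa [hQ, Fin.sum_univ_three] using e2
  have ho : ∀ a, ∀ l < idx k a, base u c a (X ^ l * Q) = 0 := by
    intro a l hl
    rw [hQ, Finset.mul_sum, map_sum]
    refine Finset.sum_eq_zero fun i _ => ?_
    rw [mul_smul_comm, map_smul, (hB _).orth a l (hl.trans_le (idx_mono (by omega) a)), smul_zero]
  have hdeg : Q.degree < ((k + 3 : ℕ) : WithBot ℕ) := by
    refine (degree_sum_le _ _).trans_lt ((Finset.sup_lt_iff (WithBot.bot_lt_coe _)).2 fun i _ => ?_)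
    exact (degree_smul_le _ _).trans_lt ((hB _).degree_lt (by omega))
  obtain ⟨R, hR⟩ := dvd_iff_isRoot.2 hd
  have hQ0 : Q = 0 := by
    rw [hR, eq_zero_of_degree_lt_of_orth hT (k := k + 2) (R := R), mul_zero]
    · rw [hR, degree_mul, degree_X_sub_C] at hdeg
      by_contra hcon
      have := add_le_add_right (not_lt.1 hcon) (1 : WithBot ℕ)
      refine absurd (this.trans_lt hdeg) ?_
      norm_cast
      omega
    · rw [hR] at ho h0 h1
      exact shifted_orth_of_base_orth h0 h1 ho
  refine hw0 (funext fun i => ?_)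
  -- Pairing with the dual type I row reads off the coefficient `w i`.
  have := congrArg (pairing (base u c) (A (k + i))) hQ
  rw [hQ0, map_zero, map_sum, Finset.sum_eq_single i] at this
  · rw [map_smul, pairing_biorthogonal (hA _) (hB _), if_pos rfl, smul_eq_mul, mul_one] at this
    exact this.symm
  · intro j _ hj
    rw [map_smul, pairing_biorthogonal (hA _) (hB _), if_neg, smul_zero]
    exact fun e => hj (Fin.ext (by omega))
  · simp

theorem eval_typeII_eq (hA : ∀ n, IsTypeI (fun a => base u c a) n (A n))
    (hB : ∀ n, IsTypeII (fun a => base u c a) n (B n)) {k : ℕ} {R : ℂ[X]}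
    (hR : IsTypeII (fun a => shifted u d a) (k + 2) R) (x : ℂ) :
    tri u d B k (k + 1) (k + 2) * (x - d) * R.eval x =
      Matrix.det
        !![(B k).eval d, u 0 (B k), u 1 (B k), (B k).eval x;
           (B (k + 1)).eval d, u 0 (B (k + 1)), u 1 (B (k + 1)), (B (k + 1)).eval x;
           (B (k + 2)).eval d, u 0 (B (k + 2)), u 1 (B (k + 2)), (B (k + 2)).eval x;
           (B (k + 3)).eval d, u 0 (B (k + 3)), u 1 (B (k + 3)), (B (k + 3)).eval x] := by
  have hmonic : ((X - C d) * R).Monic := (monic_X_sub_C d).mul hR.monic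
  have hnat : ((X - C d) * R).natDegree = k + 3 := by
    rw [(monic_X_sub_C d).natDegree_mul hR.monic, natDegree_X_sub_C, hR.natDegree_eq]
    ring
  have hdeg : ((X - C d) * R).degree < ((k + 4 : ℕ) : WithBot ℕ) := by
    rw [degree_eq_natDegree hmonic.ne_zero, hnat]
    exact_mod_cast Nat.lt_succ_self _
  have hlead : pairing (base u c) (A (k + 3)) ((X - C d) * R) = 1 := by
    rw [(hA (k + 3)).pairing_eq_coeff hdeg, ← hnat]
    exact hmonic
  have hsum := eq_sum_pairing_of_orth hA hB hdeg (base_orth_of_shifted_orth hR.orth)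
  simp only [Finset.sum_range_succ, Finset.sum_range_zero, zero_add, add_zero, hlead,
    one_smul] at hsum
  generalize pairing (base u c) (A k) ((X - C d) * R) = p at hsum
  generalize pairing (base u c) (A (k + 1)) ((X - C d) * R) = q at hsum
  generalize pairing (base u c) (A (k + 2)) ((X - C d) * R) = r at hsum
  have e0 := congrArg (eval d) hsum
  have ex := congrArg (eval x) hsum
  have e1 := congrArg (u 0) hsum
  have e2 := congrArg (u 1) hsum
  have z : ∀ a, shifted u d a R = 0 → u a ((X - C d) * R) = 0 := fun a h => h
  have z0 := z 0 (by simpa using hR.orth 0 0 (lt_idx_iff.2 (by simp)))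
  have z1 := z 1 (by simpa using hR.orth 1 0 (lt_idx_iff.2 (by simp)))
  rw [z0] at e1
  rw [z1] at e2
  simp only [eval_mul, eval_sub, eval_X, eval_C, sub_self, zero_mul, eval_add, eval_smul, map_add,
    map_smul, smul_eq_mul] at e0 ex e1 e2
  -- Each entry of the last row of the determinant is solved for: modulo the rows above, that row
  -- becomes `(0, 0, 0, (x - d) R(x))`.
  have f0 := eq_sub_of_add_eq' e0.symm
  have f1 := eq_sub_of_add_eq' e1.symm
  have f2 := eq_sub_of_add_eq' e2.symm
  have fx := eq_sub_of_add_eq' ex.symm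
  rw [f0, f1, f2, fx, tri, Matrix.det_fin_three]
  simp [Matrix.det_succ_row_zero, Fin.sum_univ_succ, Fin.succAbove]
  ring

/-- The row of type I polynomials of the transformed functionals, up to normalization. -/
def christoffelRow (u : Fin 3 → ℂ[X] →ₗ[ℂ] ℂ) (c d : ℂ) (A : ℕ → Fin 3 → ℂ[X]) (B : ℕ → ℂ[X])
    (k : ℕ) : Fin 3 → ℂ[X] :=
  ![∑ i ∈ Finset.range k, tri u d B i k (k + 1) • ((X - C c) * A i 1) -
      C (Matrix.det !![(B k).eval d, u 1 (B k); (B (k + 1)).eval d, u 1 (B (k + 1))]),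
    ∑ i ∈ Finset.range k, tri u d B i k (k + 1) • ((X - C c) * A i 2) +
      C (Matrix.det !![(B k).eval d, u 0 (B k); (B (k + 1)).eval d, u 0 (B (k + 1))]),
    ∑ i ∈ Finset.range k, tri u d B i k (k + 1) • -A i 0]

theorem degree_sum_smul_lt {k m : ℕ} {v : ℕ → ℂ} {F : ℕ → ℂ[X]}
    (h : ∀ i < k, (F i).degree < m) :
    (∑ i ∈ Finset.range k, v i • F i).degree < m :=
  (degree_sum_le _ _).trans_lt <| (Finset.sup_lt_iff (WithBot.bot_lt_coe _)).2 fun i hi =>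
    (degree_smul_le _ _).trans_lt (h i (Finset.mem_range.1 hi))

theorem degree_X_sub_C_mul_lt {p : ℂ[X]} {m : ℕ} (h : p.degree < m) (c : ℂ) :
    ((X - C c) * p).degree < ((m + 1 : ℕ) : WithBot ℕ) := by
  by_cases hp : p = 0
  · simp [hp]
  · rw [degree_mul, degree_X_sub_C, degree_eq_natDegree hp]
    rw [degree_eq_natDegree hp] at h
    norm_cast at h ⊢
    omega

theorem degree_C_lt_of_pos (r : ℂ) {m : ℕ} (h : 0 < m) : (C r).degree < m :=
  degree_C_le.trans_lt (by exact_mod_cast h)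

theorem christoffelRow_degree_lt (hA : ∀ n, IsTypeI (fun a => base u c a) n (A n)) (k : ℕ)
    (a : Fin 3) : (christoffelRow u c d A B k a).degree < idx (k + 2) a := by
  have hi : ∀ i < k, ∀ b, (A i b).degree < idx k b := fun i hi b =>
    ((hA i).degree_lt b).trans_le (by exact_mod_cast idx_mono hi b)
  fin_cases a
  · have h0 : idx (k + 2) 0 = idx k 1 + 1 := by simp [idx]; omega
    refine (degree_sub_le _ _).trans_lt (max_lt ?_ (degree_C_lt_of_pos _ ?_))
    · refine degree_sum_smul_lt fun i hik => ?_
      rw [Fin.zero_eta, h0]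
      exact degree_X_sub_C_mul_lt (hi i hik 1) c
    · simp [idx]
  · have h0 : idx (k + 2) 1 = idx k 2 + 1 := by simp [idx]
    refine (degree_add_le _ _).trans_lt (max_lt ?_ (degree_C_lt_of_pos _ ?_))
    · refine degree_sum_smul_lt fun i hik => ?_
      rw [Fin.mk_one, h0]
      exact degree_X_sub_C_mul_lt (hi i hik 2) c
    · simp [idx]
  · have h0 : idx (k + 2) 2 = idx k 0 := by simp [idx]
    change _ < ((idx (k + 2) 2 : ℕ) : WithBot ℕ)
    rw [h0]
    refine degree_sum_smul_lt fun i hik => ?_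
    rw [degree_neg]
    exact hi i hik 0

theorem sum_shifted_christoffelRow (k : ℕ) (f : ℂ[X]) :
    ∑ a, shifted u d a (f * christoffelRow u c d A B k a) =
      -∑ i ∈ Finset.range k, tri u d B i k (k + 1) * pairing (base u c) (A i) ((X - C d) * f)
      - Matrix.det !![(B k).eval d, u 1 (B k); (B (k + 1)).eval d, u 1 (B (k + 1))]
        * u 0 ((X - C d) * f)
      + Matrix.det !![(B k).eval d, u 0 (B k); (B (k + 1)).eval d, u 0 (B (k + 1))]
        * u 1 ((X - C d) * f) := by
  have hC : ∀ (w : ℂ[X] →ₗ[ℂ] ℂ) (g : ℂ[X]) (r : ℂ), w (g * C r) = r * w g := fun w g r => by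
    rw [mul_comm, ← smul_eq_C_mul, map_smul, smul_eq_mul]
  have hX : ∀ (w : ℂ[X] →ₗ[ℂ] ℂ) (g p : ℂ[X]),
      w (g * ((X - C c) * p)) = -w ((C c - X) * (g * p)) := fun w g p => by
    rw [← map_neg]
    congr 1
    ring
  have hS : ∀ (w : ℂ[X] →ₗ[ℂ] ℂ) (g : ℂ[X]) (F : ℕ → ℂ[X]),
      w (g * ∑ i ∈ Finset.range k, tri u d B i k (k + 1) • F i) =
        ∑ i ∈ Finset.range k, tri u d B i k (k + 1) * w (g * F i) := fun w g F => by
    simp only [Finset.mul_sum, mul_smul_comm, map_sum, map_smul, smul_eq_mul]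
  simp only [Fin.sum_univ_three, shifted_apply, ← mul_assoc]
  simp only [pairing_apply, Fin.sum_univ_three, base_zero, base_one, base_two]
  generalize (X - C d) * f = g
  simp only [christoffelRow, Matrix.cons_val_zero, Matrix.cons_val_one, Matrix.cons_val,
    mul_sub g, mul_add g, map_add (u _), map_sub (u _), hC, hS, hX, mul_neg, map_neg, mul_add,
    Finset.sum_add_distrib, Finset.sum_neg_distrib]
  ring

/-- With `g = (X - d) f`, the determinant is linear in its first row, so the biorthogonal expansion
of `g` sums `tri i k (k+1)` times its coefficients to the determinant with first row `(0, u 0 g, u 1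
g)`. The two constants of the row cancel exactly this. Of the terms with `i ≥ k`, two have a
repeated row; only `i = k + 2` survives, where `tri` becomes `τ`. -/
theorem sum_shifted_christoffelRow_eq (hA : ∀ n, IsTypeI (fun a => base u c a) n (A n))
    (hB : ∀ n, IsTypeII (fun a => base u c a) n (B n)) {k : ℕ} {f : ℂ[X]}
    (hf : f.degree < ((k + 2 : ℕ) : WithBot ℕ)) :
    ∑ a, shifted u d a (f * christoffelRow u c d A B k a) =
      tri u d B k (k + 1) (k + 2) * f.coeff (k + 1) := by
  have hg : ((X - C d) * f).degree < ((k + 3 : ℕ) : WithBot ℕ) := degree_X_sub_C_mul_lt hf d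
  have hlead : pairing (base u c) (A (k + 2)) ((X - C d) * f) = f.coeff (k + 1) := by
    rw [(hA (k + 2)).pairing_eq_coeff hg, sub_mul, coeff_sub, coeff_X_mul, coeff_C_mul,
      coeff_eq_zero_of_degree_lt hf, mul_zero, sub_zero]
  have hexp := eq_sum_pairing_smul hA hB hg
  have hd : ((X - C d) * f).eval d = 0 := by simp
  rw [sum_shifted_christoffelRow, ← hlead]
  generalize (X - C d) * f = g at hexp hd
  have e0 := congrArg (eval d) hexp
  have e1 := congrArg (u 0) hexp
  have e2 := congrArg (u 1) hexp
  rw [hd, eval_finsetSum] at e0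
  rw [map_sum] at e1 e2
  simp only [eval_smul, map_smul, smul_eq_mul] at e0 e1 e2
  have htri : ∀ i, tri u d B i k (k + 1) =
      (B i).eval d * (u 0 (B k) * u 1 (B (k + 1)) - u 1 (B k) * u 0 (B (k + 1)))
      - u 0 (B i) * Matrix.det !![(B k).eval d, u 1 (B k); (B (k + 1)).eval d, u 1 (B (k + 1))]
      + u 1 (B i) *
        Matrix.det !![(B k).eval d, u 0 (B k); (B (k + 1)).eval d, u 0 (B (k + 1))] := by
    intro i
    rw [tri, Matrix.det_fin_three, Matrix.det_fin_two, Matrix.det_fin_two]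
    simp
    ring
  have hsum : ∑ i ∈ Finset.range (k + 3), tri u d B i k (k + 1) * pairing (base u c) (A i) g =
      - u 0 g * Matrix.det !![(B k).eval d, u 1 (B k); (B (k + 1)).eval d, u 1 (B (k + 1))]
      + u 1 g *
        Matrix.det !![(B k).eval d, u 0 (B k); (B (k + 1)).eval d, u 0 (B (k + 1))] := by
    conv_rhs => rw [e1, e2]
    -- The vanishing value `g(d)` is inserted times its cofactor, so that each summand is a full `3
    -- × 3` determinant.
    rw [neg_mul, neg_add_eq_sub, Finset.sum_mul, Finset.sum_mul, ← Finset.sum_sub_distrib,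
      ← add_zero (∑ i ∈ Finset.range (k + 3), (_ - _)),
      ← zero_mul (u 0 (B k) * u 1 (B (k + 1)) - u 1 (B k) * u 0 (B (k + 1))), e0, Finset.sum_mul,
      ← Finset.sum_add_distrib]
    refine Finset.sum_congr rfl fun i _ => ?_
    rw [htri]
    ring
  have t0 : tri u d B k k (k + 1) = 0 := by
    rw [tri, Matrix.det_fin_three]
    simp
    ring
  have t1 : tri u d B (k + 1) k (k + 1) = 0 := by
    rw [tri, Matrix.det_fin_three]
    simp
    ring
  have t2 : tri u d B (k + 2) k (k + 1) = tri u d B k (k + 1) (k + 2) := by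
    rw [tri, tri, Matrix.det_fin_three, Matrix.det_fin_three]
    simp
    ring
  rw [Finset.sum_range_succ, Finset.sum_range_succ, Finset.sum_range_succ, t0, t1, t2] at hsum
  linear_combination -hsum

theorem isTypeI_christoffelRow (hT : HasOrthogonality fun a => shifted u d a)
    (hA : ∀ n, IsTypeI (fun a => base u c a) n (A n))
    (hB : ∀ n, IsTypeII (fun a => base u c a) n (B n)) (k : ℕ) :
    IsTypeI (fun a => shifted u d a) (k + 1) fun a =>
      (1 / tri u d B k (k + 1) (k + 2)) • christoffelRow u c d A B k a := by
  have key : ∀ l < k + 2, ∑ a, shifted u d a (X ^ l *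
      ((1 / tri u d B k (k + 1) (k + 2)) • christoffelRow u c d A B k a)) =
      (X ^ l : ℂ[X]).coeff (k + 1) := by
    intro l hl
    simp only [mul_smul_comm, map_smul]
    rw [← Finset.smul_sum, sum_shifted_christoffelRow_eq hA hB, smul_eq_mul,
      one_div_mul_eq_div, mul_div_cancel_left₀ _ (tri_ne_zero hT hA hB k)]
    rw [degree_X_pow]
    exact_mod_cast hl
  refine ⟨fun a => (degree_smul_le _ _).trans_lt (christoffelRow_degree_lt hA k a),
    fun l hl => ?_, ?_⟩
  · rw [key l (by omega), coeff_X_pow, if_neg (by omega)]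
  · rw [key (k + 1) (by omega), coeff_X_pow, if_pos rfl]

end StepLine

/-! ### Integrability for the Jacobi weights and the functionals built from them. -/

namespace JacobiPineiro

theorem ofReal_weight_eq {e β x : ℝ} (hx : x ∈ Set.Ioo (0 : ℝ) 1) :
    ((x ^ e * (1 - x) ^ β : ℝ) : ℂ) =
      (x : ℂ) ^ (((e + 1 : ℝ) : ℂ) - 1) * (1 - (x : ℂ)) ^ (((β + 1 : ℝ) : ℂ) - 1) := by
  have h1 : (0 : ℝ) ≤ 1 - x := by linarith [hx.2]
  push_cast
  rw [Complex.ofReal_cpow hx.1.le, Complex.ofReal_cpow h1, add_sub_cancel_right,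
    add_sub_cancel_right]
  push_cast
  rfl

theorem integrableOn_weight {e β : ℝ} (he : -1 < e) (hβ : -1 < β) :
    IntegrableOn (fun x : ℝ => ((x ^ e * (1 - x) ^ β : ℝ) : ℂ)) (Set.Ioo 0 1) := by
  have h := Complex.betaIntegral_convergent (u := ((e + 1 : ℝ) : ℂ)) (v := ((β + 1 : ℝ) : ℂ))
    (by rw [Complex.ofReal_re]; linarith) (by rw [Complex.ofReal_re]; linarith)
  rw [intervalIntegrable_iff_integrableOn_Ioo_of_le zero_le_one] at h
  exact h.congr_fun (fun x hx => (ofReal_weight_eq hx).symm) measurableSet_Ioo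

theorem measurable_weight (e β : ℝ) :
    Measurable fun x : ℝ => ENNReal.ofReal (x ^ e * (1 - x) ^ β) := by
  fun_prop

theorem toReal_weight {e β x : ℝ} (hx : x ∈ Set.Ioo (0 : ℝ) 1) :
    (ENNReal.ofReal (x ^ e * (1 - x) ^ β)).toReal = x ^ e * (1 - x) ^ β := by
  have h0 := hx.1
  have h1 : (0 : ℝ) ≤ 1 - x := by linarith [hx.2]
  exact ENNReal.toReal_ofReal (by positivity)

theorem integrable_meas_iff {e β : ℝ} {g : ℝ → ℂ} :
    Integrable g (meas e β) ↔
      IntegrableOn (fun x => ((x ^ e * (1 - x) ^ β : ℝ) : ℂ) * g x) (Set.Ioo 0 1) := by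
  rw [meas, integrable_withDensity_iff_integrable_smul' (measurable_weight e β) (by simp),
    ← IntegrableOn, integrableOn_Icc_iff_integrableOn_Ioo]
  refine integrableOn_congr_fun (fun x hx => ?_) measurableSet_Ioo
  simp only [toReal_weight hx, Complex.real_smul]

theorem integral_meas (e β : ℝ) (g : ℝ → ℂ) :
    ∫ x, g x ∂(meas e β) = ∫ x in Set.Ioo 0 1, ((x ^ e * (1 - x) ^ β : ℝ) : ℂ) * g x := by
  rw [meas, integral_withDensity_eq_integral_toReal_smul (measurable_weight e β) (by simp),
    integral_Icc_eq_integral_Ioo]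
  refine setIntegral_congr_fun measurableSet_Ioo (fun x hx => ?_)
  simp only [toReal_weight hx, Complex.real_smul]

theorem integrable_continuousOn_mul {e β : ℝ} {f g : ℝ → ℂ} (hf : ContinuousOn f (Set.Icc 0 1))
    (hg : Integrable g (meas e β)) : Integrable (fun x => f x * g x) (meas e β) := by
  have hac : meas e β ≪ volume.restrict (Set.Icc 0 1) := withDensity_absolutelyContinuous _ _
  obtain ⟨M, hM⟩ := isCompact_Icc.exists_bound_of_continuousOn hf
  refine hg.bdd_mul ((hf.aestronglyMeasurable measurableSet_Icc).mono_ac hac) (c := M) ?_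
  exact hac.ae_le ((ae_restrict_mem measurableSet_Icc).mono hM)

theorem integrable_one {e β : ℝ} (he : -1 < e) (hβ : -1 < β) :
    Integrable (fun _ => (1 : ℂ)) (meas e β) := by
  rw [integrable_meas_iff]
  simpa only [mul_one] using integrableOn_weight he hβ

theorem continuous_eval_ofReal (f : ℂ[X]) : Continuous fun x : ℝ => f.eval (x : ℂ) :=
  f.continuous.comp Complex.continuous_ofReal

theorem integrable_eval_mul {e β : ℝ} (f : ℂ[X]) {g : ℝ → ℂ} (hg : Integrable g (meas e β)) :
    Integrable (fun x : ℝ => f.eval (x : ℂ) * g x) (meas e β) :=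
  integrable_continuousOn_mul (continuous_eval_ofReal f).continuousOn hg

theorem integrable_eval {e β : ℝ} (he : -1 < e) (hβ : -1 < β) (f : ℂ[X]) :
    Integrable (fun x : ℝ => f.eval (x : ℂ)) (meas e β) := by
  simpa only [mul_one] using integrable_eval_mul f (integrable_one he hβ)

/-- At an endpoint the kernel lowers the corresponding exponent by one, which stays above `-1`;
elsewhere it is bounded on `[0, 1]`. -/
theorem integrable_cauchy {e β c : ℝ} (he : -1 < e) (hβ : -1 < β) (hc : c ≤ 0 ∨ 1 ≤ c)
    (hc0 : c = 0 → 0 < e) (hc1 : c = 1 → 0 < β) :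
    Integrable (fun x : ℝ => ((c : ℂ) - x)⁻¹) (meas e β) := by
  rcases eq_or_ne c 0 with rfl | h0
  · rw [integrable_meas_iff]
    refine (integrableOn_weight (e := e - 1) (by linarith [hc0 rfl]) hβ).neg.congr_fun
      (fun x hx => ?_) measurableSet_Ioo
    have hx0 : (x : ℂ) ≠ 0 := by exact_mod_cast hx.1.ne'
    have : x ^ e = x ^ (e - 1) * x := by
      rw [← Real.rpow_add_one hx.1.ne', sub_add_cancel]
    simp only [Pi.neg_apply, this]
    push_cast
    field_simp
    simp
  rcases eq_or_ne c 1 with rfl | h1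
  · rw [integrable_meas_iff]
    refine (integrableOn_weight (β := β - 1) he (by linarith [hc1 rfl])).congr_fun
      (fun x hx => ?_) measurableSet_Ioo
    have hx' : 1 - x ≠ 0 := by linarith [hx.2]
    have hx0 : 1 - (x : ℂ) ≠ 0 := by exact_mod_cast hx'
    have : (1 - x) ^ β = (1 - x) ^ (β - 1) * (1 - x) := by
      rw [← Real.rpow_add_one hx', sub_add_cancel]
    simp only [this]
    push_cast
    field_simp
  · simpa only [mul_one] using integrable_continuousOn_mul (f := fun x : ℝ => ((c : ℂ) - x)⁻¹)
      (ContinuousOn.inv₀ (by fun_prop) fun x hx => by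
        rw [sub_ne_zero]
        norm_cast
        rintro rfl
        rcases hc with hc | hc
        · exact h0 (le_antisymm hc hx.1)
        · exact h1 (le_antisymm hx.2 hc)) (integrable_one he hβ)

/-- The Jacobi–Piñeiro functionals as linear maps. -/
def linearFunctional {α : Fin 3 → ℝ} {β : ℝ} (hα : ∀ a, -1 < α a) (hβ : -1 < β) (a : Fin 3) :
    ℂ[X] →ₗ[ℂ] ℂ where
  toFun := functional α β a
  map_add' f g := by
    simp only [functional, eval_add]
    exact integral_add (integrable_eval (hα a) hβ f) (integrable_eval (hα a) hβ g)
  map_smul' r f := by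
    simp only [functional, eval_smul, smul_eq_mul, RingHom.id_apply]
    exact integral_const_mul r _

/-- The functional `f ↦ ∫ f(x) / (c - x) dμ(x) + ξ f(c)`. -/
def cauchyFunctional {e β c : ℝ}
    (h : Integrable (fun x : ℝ => ((c : ℂ) - x)⁻¹) (meas e β)) (ξ : ℂ) : ℂ[X] →ₗ[ℂ] ℂ where
  toFun f := (∫ x : ℝ, f.eval (x : ℂ) / ((c : ℂ) - x) ∂(meas e β)) + ξ * f.eval (c : ℂ)
  map_add' f g := by
    simp only [eval_add, div_eq_mul_inv, add_mul]
    rw [integral_add (integrable_eval_mul f h) (integrable_eval_mul g h)]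
    ring
  map_smul' r f := by
    simp only [eval_smul, smul_eq_mul, RingHom.id_apply, mul_div_assoc]
    rw [integral_const_mul]
    ring

theorem ae_ne (e β c : ℝ) : ∀ᵐ x ∂(meas e β), x ≠ c := by
  have hac : meas e β ≪ volume :=
    (withDensity_absolutelyContinuous _ _).trans Measure.restrict_le_self.absolutelyContinuous
  have h : ∀ᵐ x : ℝ, x ≠ c := by
    rw [ae_iff]
    simp
  exact hac.ae_le h

theorem cauchyFunctional_mul {e β c : ℝ}
    (h : Integrable (fun x : ℝ => ((c : ℂ) - x)⁻¹) (meas e β)) (ξ : ℂ) (f : ℂ[X]) :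
    cauchyFunctional h ξ ((C (c : ℂ) - X) * f) = ∫ x : ℝ, f.eval (x : ℂ) ∂(meas e β) := by
  change (∫ x : ℝ, ((C (c : ℂ) - X) * f).eval (x : ℂ) / ((c : ℂ) - x) ∂(meas e β)) +
    ξ * ((C (c : ℂ) - X) * f).eval (c : ℂ) = _
  simp only [eval_mul, eval_sub, eval_C, eval_X, sub_self, zero_mul, mul_zero, add_zero]
  refine integral_congr_ae ((ae_ne e β c).mono fun x hx => ?_)
  have hx' : (c : ℂ) - x ≠ 0 := sub_ne_zero.2 (by exact_mod_cast hx.symm)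
  exact mul_div_cancel_left₀ _ hx'

/-! ### Beta-function moments and orthogonality for the Jacobi–Piñeiro row. -/

theorem integral_pow_meas (e β : ℝ) (m : ℕ) :
    ∫ x : ℝ, (x : ℂ) ^ m ∂(meas e β) =
      Complex.betaIntegral (((e + 1 : ℝ) : ℂ) + m) ((β + 1 : ℝ) : ℂ) := by
  rw [integral_meas, Complex.betaIntegral, intervalIntegral.integral_of_le zero_le_one,
    integral_Ioc_eq_integral_Ioo]
  refine setIntegral_congr_fun measurableSet_Ioo fun x hx => ?_
  have hx0 : (x : ℂ) ≠ 0 := by exact_mod_cast hx.1.ne'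
  simp only [ofReal_weight_eq hx]
  rw [add_sub_right_comm, Complex.cpow_add _ _ hx0, Complex.cpow_natCast]
  ring

theorem betaIntegral_add_one {u v : ℂ} (hu : 0 < u.re) (hv : 0 < v.re) :
    Complex.betaIntegral (u + 1) v * (u + v) = u * Complex.betaIntegral u v := by
  have huv : 0 < (u + v).re := by rw [Complex.add_re]; linarith
  have hu1 : 0 < (u + 1).re := by rw [Complex.add_re, Complex.one_re]; linarith
  have h1 := Complex.Gamma_mul_Gamma_eq_betaIntegral hu hv
  have h2 := Complex.Gamma_mul_Gamma_eq_betaIntegral hu1 hv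
  have nz : ∀ z : ℂ, 0 < z.re → z ≠ 0 := fun z hz h => by simp [h] at hz
  rw [Complex.Gamma_add_one u (nz u hu), add_right_comm,
    Complex.Gamma_add_one _ (nz _ huv)] at h2
  refine mul_left_cancel₀ (Complex.Gamma_ne_zero_of_re_pos huv) ?_
  linear_combination u * h1 - h2

theorem betaIntegral_add_natCast {u v : ℂ} (hu : 0 < u.re) (hv : 0 < v.re) (i : ℕ) :
    Complex.betaIntegral (u + i) v * ∏ t ∈ Finset.range i, (u + v + t) =
      (∏ t ∈ Finset.range i, (u + t)) * Complex.betaIntegral u v := by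
  induction i with
  | zero => simp
  | succ i ih =>
    have hui : 0 < (u + i).re := by
      rw [Complex.add_re, Complex.natCast_re]
      positivity
    have := betaIntegral_add_one hui hv
    rw [Finset.prod_range_succ, Finset.prod_range_succ]
    push_cast
    rw [← add_assoc]
    linear_combination (∏ t ∈ Finset.range i, (u + v + t)) * this + (u + i) * ih

theorem betaIntegral_ne_zero {u v : ℂ} (hu : 0 < u.re) (hv : 0 < v.re) :
    Complex.betaIntegral u v ≠ 0 := by
  intro h
  have h1 := Complex.Gamma_mul_Gamma_eq_betaIntegral hu hv
  rw [h, mul_zero] at h1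
  exact mul_ne_zero (Complex.Gamma_ne_zero_of_re_pos hu) (Complex.Gamma_ne_zero_of_re_pos hv) h1

/-- The polynomial `(X)_i (X + v + i)_{K - i}` in Pochhammer notation. -/
def pochProd (v : ℂ) (K i : ℕ) : ℂ[X] :=
  (∏ t ∈ Finset.range i, (X + C (t : ℂ))) * ∏ t ∈ Finset.Ico i K, (X + C (v + t))

theorem eval_pochProd (v : ℂ) (K i : ℕ) (s : ℂ) : (pochProd v K i).eval s =
    (∏ t ∈ Finset.range i, (s + t)) * ∏ t ∈ Finset.Ico i K, (s + v + t) := by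
  simp [pochProd, eval_prod, add_assoc]

theorem natDegree_pochProd_le (v : ℂ) {K i : ℕ} (h : i ≤ K) : (pochProd v K i).natDegree ≤ K := by
  refine natDegree_mul_le.trans ?_
  rw [natDegree_prod_of_monic _ _ fun t _ => monic_X_add_C _,
    natDegree_prod_of_monic _ _ fun t _ => monic_X_add_C _]
  simp only [natDegree_X_add_C, Finset.sum_const, Finset.card_range, Nat.card_Ico, smul_eq_mul]
  omega

theorem eval_pochProd_neg_of_lt (v : ℂ) (K : ℕ) {i j : ℕ} (h : j < i) :
    (pochProd v K i).eval (-(j : ℂ)) = 0 := by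
  rw [eval_pochProd, Finset.prod_eq_zero (Finset.mem_range.2 h) (neg_add_cancel _), zero_mul]

theorem eval_pochProd_neg_self {v : ℂ} (hv : 0 < v.re) (K i : ℕ) :
    (pochProd v K i).eval (-(i : ℂ)) ≠ 0 := by
  rw [eval_pochProd]
  refine mul_ne_zero (Finset.prod_ne_zero_iff.2 fun t ht => ?_)
    (Finset.prod_ne_zero_iff.2 fun t ht => ?_)
  · rw [neg_add_eq_sub, sub_ne_zero]
    exact_mod_cast (Finset.mem_range.1 ht).ne
  · intro h
    have h1 := congrArg Complex.re h
    have h2 : (i : ℝ) ≤ t := by exact_mod_cast (Finset.mem_Ico.1 ht).1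
    simp only [Complex.add_re, Complex.neg_re, Complex.natCast_re, Complex.zero_re] at h1
    linarith

/-- Evaluation at `0, -1, -2, …` is triangular: at `-n` the terms `i > n` vanish and the term `i =
n` has a nonzero factor. -/
theorem eq_zero_of_sum_pochProd_eq_zero {v : ℂ} (hv : 0 < v.re) (K : ℕ) {w : Fin (K + 1) → ℂ}
    (h : ∑ i, C (w i) * pochProd v K i = 0) : w = 0 := by
  have key : ∀ n (hn : n < K + 1), w ⟨n, hn⟩ = 0 := by
    intro n
    induction n using Nat.strong_induction_on with
    | _ n ih =>
      intro hn
      have h1 := congrArg (eval (-(n : ℂ))) h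
      rw [eval_finsetSum, Finset.sum_eq_single ⟨n, hn⟩, eval_mul, eval_C, eval_zero] at h1
      · exact (mul_eq_zero.1 h1).resolve_right (eval_pochProd_neg_self hv K n)
      · intro i _ hi
        rw [eval_mul, eval_C]
        rcases lt_or_gt_of_ne (fun e => hi (Fin.ext e) : (i : ℕ) ≠ n) with hin | hin
        · rw [ih i hin i.isLt, zero_mul]
        · rw [eval_pochProd_neg_of_lt v K hin, mul_zero]
      · simp
  ext i
  exact key i i.isLt

/-- Matrices of values of the beta function at distinct shifted points are nonsingular. -/
theorem eq_zero_of_sum_betaIntegral_eq_zero {v : ℂ} (hv : 0 < v.re) {K : ℕ}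
    {s : Fin (K + 1) → ℂ} (hs : ∀ j, 0 < (s j).re) (hinj : Function.Injective s)
    {w : Fin (K + 1) → ℂ}
    (h : ∀ j, ∑ i, w i * Complex.betaIntegral (s j + (i : ℕ)) v = 0) : w = 0 := by
  refine eq_zero_of_sum_pochProd_eq_zero hv K ?_
  -- Since `B(s+i, v) = B(s, v) (s)_i / (s+v)_i`, multiplying the relation by `(s+v)_K` leaves `B(s,
  -- v)` times a polynomial in `s` of degree at most `K`, with `K + 1` distinct roots.
  refine eq_zero_of_natDegree_lt_card_of_eval_eq_zero _ hinj (fun j => ?_) ?_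
  · refine mul_right_cancel₀ (betaIntegral_ne_zero (hs j) hv) ?_
    rw [zero_mul, eval_finsetSum, Finset.sum_mul]
    have h2 := congrArg (· * ∏ t ∈ Finset.range K, (s j + v + t)) (h j)
    simp only [zero_mul, Finset.sum_mul] at h2
    rw [← h2]
    refine Finset.sum_congr rfl fun i _ => ?_
    rw [eval_mul, eval_C, eval_pochProd,
      ← Finset.prod_range_mul_prod_Ico _ (Nat.lt_succ_iff.1 i.isLt)]
    linear_combination - w i * (∏ t ∈ Finset.Ico (i : ℕ) K, (s j + v + t)) *
      betaIntegral_add_natCast (hs j) hv i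
  · rw [Fintype.card_fin, Nat.lt_succ_iff]
    refine natDegree_sum_le_of_forall_le _ _ fun i _ => ?_
    exact (natDegree_C_mul_le _ _).trans (natDegree_pochProd_le v (Nat.lt_succ_iff.1 i.isLt))

/-- Column `3m + a` of the moment matrix consists of beta values at `α a + 1 + m` plus the row
index. These base points are distinct because the exponents do not differ by integers. -/
theorem hasOrthogonality {α : Fin 3 → ℝ} {β : ℝ} (hα : ∀ a, -1 < α a) (hβ : -1 < β)
    (hAT : ∀ a b : Fin 3, a ≠ b → ∀ m : ℤ, α a - α b ≠ m) :
    StepLine.HasOrthogonality (functional α β) := by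
  intro k
  rcases k with _ | K
  · simp
  intro hdet
  obtain ⟨w, hw0, hw⟩ := Matrix.exists_vecMul_eq_zero_iff.2 hdet
  refine hw0 (eq_zero_of_sum_betaIntegral_eq_zero (v := ((β + 1 : ℝ) : ℂ))
    (s := fun j => ((α (Fin.ofNat 3 (j : ℕ)) + 1 + ((j : ℕ) / 3 : ℕ) : ℝ) : ℂ)) ?_ ?_ ?_ ?_)
  · rw [Complex.ofReal_re]
    linarith
  · intro j
    rw [Complex.ofReal_re]
    have : (0 : ℝ) ≤ (((j : ℕ) / 3 : ℕ) : ℝ) := Nat.cast_nonneg _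
    linarith [hα (Fin.ofNat 3 (j : ℕ))]
  · intro i j hij
    have hij' := Complex.ofReal_injective hij
    by_cases hab : (Fin.ofNat 3 (i : ℕ)) = Fin.ofNat 3 (j : ℕ)
    · rw [hab] at hij'
      have h1 : (i : ℕ) / 3 = (j : ℕ) / 3 := by
        have := add_left_cancel hij'
        exact_mod_cast this
      have h2 : (i : ℕ) % 3 = (j : ℕ) % 3 := congrArg Fin.val hab
      exact Fin.ext (by omega)
    · refine absurd ?_ (hAT _ _ hab ((((j : ℕ) / 3 : ℕ) : ℤ) - (((i : ℕ) / 3 : ℕ) : ℤ)))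
      rw [Int.cast_sub, Int.cast_natCast, Int.cast_natCast]
      linarith
  · intro j
    refine Eq.trans ?_ (congrFun hw j)
    simp only [Matrix.vecMul, dotProduct, StepLine.momentMatrix, Matrix.of_apply, functional,
      eval_pow, eval_X, integral_pow_meas]
    refine Finset.sum_congr rfl fun i _ => ?_
    push_cast
    ring_nf

end JacobiPineiro

/-! ### Identification of the two rows of measures, and the conclusion. -/

namespace JacobiPineiro
open StepLine

/-- The masses `r`, `s` are free because `c - X` vanishes at `c`. -/
theorem functional_eq_base {α : Fin 3 → ℝ} {β c : ℝ} (hα : ∀ a, -1 < α a) (hβ : -1 < β)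
    (h₁ : Integrable (fun x : ℝ => ((c : ℂ) - x)⁻¹) (meas (α 1) β))
    (h₂ : Integrable (fun x : ℝ => ((c : ℂ) - x)⁻¹) (meas (α 2) β)) (r s : ℂ) :
    functional α β = fun a =>
      ⇑(base ![cauchyFunctional h₁ r, cauchyFunctional h₂ s, linearFunctional hα hβ 0] c a) := by
  funext a f
  fin_cases a
  · rfl
  · exact (cauchyFunctional_mul h₁ r f).symm
  · exact (cauchyFunctional_mul h₂ s f).symm

theorem perturbed_eq_shifted {α : Fin 3 → ℝ} {β c d : ℝ} (hα : ∀ a, -1 < α a) (hβ : -1 < β)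
    (h₁ : Integrable (fun x : ℝ => ((c : ℂ) - x)⁻¹) (meas (α 1) β))
    (h₂ : Integrable (fun x : ℝ => ((c : ℂ) - x)⁻¹) (meas (α 2) β)) (ξ₁ ξ₂ : ℝ → ℂ) :
    perturbed α β c d ξ₁ ξ₂ = fun a =>
      ⇑(shifted ![cauchyFunctional h₁ (ξ₁ c), cauchyFunctional h₂ (ξ₂ c),
        linearFunctional hα hβ 0] d a) := by
  have key : ∀ {e : ℝ} (h : Integrable (fun x : ℝ => ((c : ℂ) - x)⁻¹) (meas e β)) (r : ℂ)
      (f : ℂ[X]), (∫ x : ℝ, f.eval (x : ℂ) * (((x : ℂ) - d) / ((c : ℂ) - x)) ∂(meas e β))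
        + ((c : ℂ) - d) * r * f.eval (c : ℂ) = cauchyFunctional h r ((X - C (d : ℂ)) * f) := by
    intro e h r f
    change _ = (∫ x : ℝ, ((X - C (d : ℂ)) * f).eval (x : ℂ) / ((c : ℂ) - x) ∂(meas e β)) +
      r * ((X - C (d : ℂ)) * f).eval (c : ℂ)
    simp only [eval_mul, eval_sub, eval_X, eval_C]
    congr 1
    · congr 1
      funext x
      ring
    · ring
  funext a f
  fin_cases a
  · exact key h₁ (ξ₁ c) f
  · exact key h₂ (ξ₂ c) f
  · change (∫ x : ℝ, f.eval (x : ℂ) * ((x : ℂ) - d) ∂(meas (α 0) β)) =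
      ∫ x : ℝ, ((X - C (d : ℂ)) * f).eval (x : ℂ) ∂(meas (α 0) β)
    simp only [eval_mul, eval_sub, eval_X, eval_C, mul_comm]

end JacobiPineiro

end

theorem mainTheorem10 (α : Fin 3 → ℝ) (β c d : ℝ) (ξ₁ ξ₂ : ℝ → ℂ)
    (hα : ∀ a, -1 < α a) (hβ : -1 < β)
    (hAT : ∀ a b : Fin 3, a ≠ b → ∀ m : ℤ, α a - α b ≠ m)
    (hc : c ≤ 0 ∨ 1 ≤ c) (hd : d ≤ 0 ∨ 1 ≤ d)
    (hc0 : c = 0 → 0 < α 1 ∧ 0 < α 2) (hc1 : c = 1 → 0 < β)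
    (hpert : StepLine.HasOrthogonality (perturbed α β c d ξ₁ ξ₂))
    (n : ℕ) (hn : 1 < n) :
    τ α β c d ξ₁ ξ₂ n ≠ 0 ∧
    (∀ x : ℂ,
      (fun a => (PtI α β c d ξ₁ ξ₂ (n - 1) a).eval x) =
        (1 / τ α β c d ξ₁ ξ₂ n) •
            ∑ i ∈ Finset.range (n - 2),
              det₃ α β c d ξ₁ ξ₂ i (n - 2) (n - 1) •
                ![(x - c) * (PI α β i 1).eval x,
                  (x - c) * (PI α β i 2).eval x,
                  -(PI α β i 0).eval x]
          + (1 / τ α β c d ξ₁ ξ₂ n) •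
            ![-Matrix.det !![(P α β (n - 2)).eval (d : ℂ), W₃ α β c ξ₂ (n - 2);
                             (P α β (n - 1)).eval (d : ℂ), W₃ α β c ξ₂ (n - 1)],
              Matrix.det !![(P α β (n - 2)).eval (d : ℂ), W₂ α β c ξ₁ (n - 2);
                            (P α β (n - 1)).eval (d : ℂ), W₂ α β c ξ₁ (n - 1)],
              0]) ∧
    (∀ x : ℂ, x ≠ d →
      (Pt α β c d ξ₁ ξ₂ n).eval x =
        1 / (τ α β c d ξ₁ ξ₂ n * (x - d)) *
          Matrix.det
            !![(P α β (n - 2)).eval (d : ℂ), W₂ α β c ξ₁ (n - 2), W₃ α β c ξ₂ (n - 2),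
                 (P α β (n - 2)).eval x;
               (P α β (n - 1)).eval (d : ℂ), W₂ α β c ξ₁ (n - 1), W₃ α β c ξ₂ (n - 1),
                 (P α β (n - 1)).eval x;
               (P α β n).eval (d : ℂ), W₂ α β c ξ₁ n, W₃ α β c ξ₂ n,
                 (P α β n).eval x;
               (P α β (n + 1)).eval (d : ℂ), W₂ α β c ξ₁ (n + 1), W₃ α β c ξ₂ (n + 1),
                 (P α β (n + 1)).eval x]) := by

  -- This removes the truncated subtractions; the type I row then has index `k + 1` and multi-index
  -- of size `k + 2`.
  obtain ⟨k, rfl⟩ : ∃ k, n = k + 2 := ⟨n - 2, by omega⟩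
  have h₁ := integrable_cauchy (hα 1) hβ hc (fun h => (hc0 h).1) hc1
  have h₂ := integrable_cauchy (hα 2) hβ hc (fun h => (hc0 h).2) hc1
  set u : Fin 3 → ℂ[X] →ₗ[ℂ] ℂ :=
    ![cauchyFunctional h₁ (ξ₁ c), cauchyFunctional h₂ (ξ₂ c), linearFunctional hα hβ 0] with hu
  have hL : functional α β = fun a => ⇑(StepLine.base u c a) :=
    functional_eq_base hα hβ h₁ h₂ (ξ₁ c) (ξ₂ c)
  have hT : perturbed α β c d ξ₁ ξ₂ = fun a => ⇑(StepLine.shifted u d a) :=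
    perturbed_eq_shifted hα hβ h₁ h₂ ξ₁ ξ₂
  have hLo := hasOrthogonality hα hβ hAT
  rw [hL] at hLo
  have hA : ∀ n, StepLine.IsTypeI (fun a => StepLine.base u c a) n (PI α β n) := fun n => by
    have := StepLine.isTypeI_typeI hLo n
    rwa [← hL] at this ⊢
  have hB : ∀ n, StepLine.IsTypeII (fun a => StepLine.base u c a) n (P α β n) := fun n => by
    have := StepLine.isTypeII_typeII hLo n
    rwa [← hL] at this ⊢
  rw [hT] at hpert
  have hPt : StepLine.IsTypeII (fun a => StepLine.shifted u d a) (k + 2)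
      (Pt α β c d ξ₁ ξ₂ (k + 2)) := by
    have := StepLine.isTypeII_typeII hpert (k + 2)
    rwa [← hT] at this ⊢
  have hPtI : StepLine.IsTypeI (fun a => StepLine.shifted u d a) (k + 1)
      (PtI α β c d ξ₁ ξ₂ (k + 1)) := by
    have := StepLine.isTypeI_typeI hpert (k + 1)
    rwa [← hT] at this ⊢
  have hτ : τ α β c d ξ₁ ξ₂ (k + 2) = StepLine.tri u d (P α β) k (k + 1) (k + 2) := rfl
  have hτ0 := StepLine.tri_ne_zero hpert hA hB k
  refine ⟨by rwa [hτ], fun x => ?_, fun x hx => ?_⟩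
  · have hrow := hPtI.eq hpert (StepLine.isTypeI_christoffelRow hpert hA hB k)
    have hdet : ∀ i, det₃ α β c d ξ₁ ξ₂ i k (k + 1) = StepLine.tri u d (P α β) i k (k + 1) :=
      fun i => rfl
    have hW₂ : ∀ i, W₂ α β c ξ₁ i = u 0 (P α β i) := fun i => rfl
    have hW₃ : ∀ i, W₃ α β c ξ₂ i = u 1 (P α β i) := fun i => rfl
    simp only [Nat.add_sub_cancel, show k + 2 - 1 = k + 1 from rfl, hrow, hτ, hdet, hW₂, hW₃,
      ← smul_add]
    funext a
    simp only [Pi.smul_apply, Pi.add_apply, Finset.sum_apply, eval_smul]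
    congr 1
    fin_cases a <;>
      simp [StepLine.christoffelRow, eval_finsetSum, sub_eq_add_neg]
  · have h := StepLine.eval_typeII_eq hA hB hPt x
    rw [hτ, one_div, eq_inv_mul_iff_mul_eq₀ (mul_ne_zero hτ0 (sub_ne_zero.2 hx))]
    exact h
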